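/- All graphs are finite and simple. In the game of Cops and Robbers on a graph $G$, $k$ cops are first placed on vertices of $G$ (several cops may share a vertex), then the robber is placed on a vertex; afterwards the two sides alternate turns, the cops moving first. On the cops' turn each cop stays or moves to an adjacent vertex, and on the robber's turn the robber stays or moves to an adjacent vertex; both sides see all positions. The cops win if after finitely many moves a cop lands on the vertex occupied by the robber. The cop number $c(G)$ is the least $k$ such that $k$ cops have a strategy that wins against every play of the robber. Let $\alpha(G)$ be the independence number of $G$, that is, the largest size of a set of pairwise non-adjacent vertices. A graph $G$ is perfect if $\chi(H)=\omega(H)$ for every induced subgraph $H$ of $G$, where $\chi$ is the chromatic number and $\omega$ the clique number. Theorem. If $G$ is a connected perfect graph with $\alpha(G)\ge 4$, then $c(G)<\alpha(G)$. -/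

import Mathlib

namespace SimpleGraph

variable {V : Type*}

/-- A graph is perfect if every induced subgraph `H` satisfies `χ(H) = ω(H)`. -/
def IsPerfect (G : SimpleGraph V) : Prop :=
  ∀ s : Set V, (G.induce s).chromaticNumber = ((G.induce s).cliqueNum : ℕ∞)

/-- In one turn, a token on vertex `u` may stay at `u` or move to a neighbour of `u`. -/
def Step (G : SimpleGraph V) (u v : V) : Prop :=
  v = u ∨ G.Adj u v

/-- A strategy for `k` cops: given the list of all vertices that the robber has occupied so far
(most recent first), it says where the cops stand after their answer. The empty list gives the
initial placement, which is made before the robber is placed. The earlier positions of the cops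
are determined by the strategy and the robber's past, so this is the whole information available
to the cops. Several cops may share a vertex. -/
structure CopStrategy (G : SimpleGraph V) (k : ℕ) where
  /-- The positions of the cops. -/
  pos : List V → Fin k → V
  /-- On each cop turn, every cop stays where it is or moves to an adjacent vertex. -/
  legal : ∀ (h : List V) (r : V) (i : Fin k), G.Step (pos h i) (pos (r :: h) i)

/-- The robber's itinerary: it starts at the vertex `r 0`, chosen arbitrarily, and on each of its
turns stays or moves to an adjacent vertex. -/
def IsRobberPlay (G : SimpleGraph V) (r : ℕ → V) : Prop :=
  ∀ n, G.Step (r n) (r (n + 1))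

/-- The first `n` vertices of the robber's itinerary, most recent first. -/
def robberHistory (r : ℕ → V) : ℕ → List V
  | 0 => []
  | n + 1 => r n :: robberHistory r n

/-- A cop strategy is winning if, however the robber plays, on some cop turn (the one following
the robber's arrival at `r n`) a cop lands on the vertex occupied by the robber. -/
def CopStrategy.IsWinning {G : SimpleGraph V} {k : ℕ} (σ : G.CopStrategy k) : Prop :=
  ∀ r : ℕ → V, G.IsRobberPlay r → ∃ (n : ℕ) (i : Fin k), σ.pos (robberHistory r (n + 1)) i = r n

/-- `k` cops can win the game of Cops and Robbers on `G`. -/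
def CopsWin (G : SimpleGraph V) (k : ℕ) : Prop :=
  ∃ σ : G.CopStrategy k, σ.IsWinning

/-- The cop number `c(G)` of a finite graph: the least `k` such that `k` cops can win. -/
noncomputable def copNumber (G : SimpleGraph V) : ℕ :=
  sInf {k | G.CopsWin k}

end SimpleGraph

/-! By the weak perfect graph theorem, `V` splits into `α(G)` nonempty cliques
(`IsPerfect.exists_isCliqueColouring`). Put a cop in every clique but one: a robber in a guarded
clique is caught at once, so he must stay in the unguarded one. When the cops change which clique is
unguarded, he has to move into the new one.

`exists_catchableBut` wins this way with four cliques at hand. If two cliques are not joined by an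
edge, one of them needs no guard while the robber is in the other, and its cop can go after him. If
some induced path `a b c` has ends seeing a common fourth clique, one forced move would complete an
induced 5-cycle, which a perfect graph lacks. If there is no such path, at most two forced moves
lead the robber to a vertex with no neighbour in the only unguarded clique.

The clique cover `IsPerfect.exists_clique_cover` follows Gasparyan's linear algebra proof. -/

namespace SimpleGraph

/-! ### Winning positions and strategies -/

section Game

variable {V : Type*} (G : SimpleGraph V) {ι : Type*}

/-- Cops standing at `p`, with the robber at `r` and the cops to move, can catch the robber within
`n` cop turns. -/
def CatchableIn : ℕ → (ι → V) → V → Prop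
  | 0, _, _ => False
  | n + 1, p, r => ∃ q : ι → V, (∀ i, G.Step (p i) (q i)) ∧
      ((∃ i, q i = r) ∨ ∀ r', G.Step r r' → CatchableIn n q r')

/-- Cops standing at `p`, with the robber at `r` and the cops to move, can catch the robber. -/
def Catchable (p : ι → V) (r : V) : Prop :=
  ∃ n, G.CatchableIn n p r

variable {G}

theorem CatchableIn.succ {n : ℕ} {p : ι → V} {r : V} (h : G.CatchableIn n p r) :
    G.CatchableIn (n + 1) p r := by
  induction n generalizing p r with
  | zero => exact h.elim
  | succ n ih =>
    obtain ⟨q, hq, h⟩ := h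
    exact ⟨q, hq, h.imp id fun h r' hr => ih (h r' hr)⟩

theorem CatchableIn.mono {n m : ℕ} (hnm : n ≤ m) {p : ι → V} {r : V} (h : G.CatchableIn n p r) :
    G.CatchableIn m p r := by
  induction hnm with
  | refl => exact h
  | step _ ih => exact ih.succ

theorem Catchable.of_step {p : ι → V} {r : V} (i : ι) (h : G.Step (p i) r) : G.Catchable p r := by
  classical
  refine ⟨1, Function.update p i r, fun j => ?_, Or.inl ⟨i, by simp⟩⟩
  by_cases hj : j = i
  · subst hj; simpa using h
  · simp [hj, Step]

theorem Catchable.of_move [Finite V] {p q : ι → V} {r : V} (hq : ∀ i, G.Step (p i) (q i))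
    (h : ∀ r', G.Step r r' → G.Catchable q r') : G.Catchable p r := by
  classical
  have h' : ∀ r', ∃ n, G.Step r r' → G.CatchableIn n q r' := fun r' => by
    by_cases hr : G.Step r r'
    · obtain ⟨n, hn⟩ := h r' hr
      exact ⟨n, fun _ => hn⟩
    · exact ⟨0, fun h => (hr h).elim⟩
  choose n hn using h'
  obtain ⟨N, hN⟩ := Finite.exists_le n
  exact ⟨N + 1, q, hq, Or.inr fun r' hr => (hn r' hr).mono (hN r')⟩

theorem CatchableIn.comp_equiv {κ : Type*} (e : κ ≃ ι) {n : ℕ} {p : ι → V} {r : V}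
    (h : G.CatchableIn n p r) : G.CatchableIn n (p ∘ e) r := by
  induction n generalizing p r with
  | zero => exact h
  | succ n ih =>
    obtain ⟨q, hq, h⟩ := h
    refine ⟨q ∘ e, fun i => hq _, h.imp ?_ fun h r' hr => ih (h r' hr)⟩
    rintro ⟨i, rfl⟩
    exact ⟨e.symm i, by simp⟩

/-- An answer chosen for the least winning time serves every `n` at once, so the cops can play
positionally. -/
theorem exists_optimal_answer (p : ι → V) (r : V) : ∃ q : ι → V, (∀ i, G.Step (p i) (q i)) ∧
    ∀ n, G.CatchableIn (n + 1) p r →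
      (∃ i, q i = r) ∨ ∀ r', G.Step r r' → G.CatchableIn n q r' := by
  classical
  by_cases h : G.Catchable p r
  · obtain ⟨m, hm⟩ : ∃ m, Nat.find h = m + 1 := Nat.exists_eq_succ_of_ne_zero fun h0 => by
      have := Nat.find_spec h
      rw [h0] at this
      exact this
    have hs := Nat.find_spec h
    rw [hm] at hs
    obtain ⟨q, hq, hc⟩ := hs
    refine ⟨q, hq, fun n hn => hc.imp id fun hc r' hr => (hc r' hr).mono ?_⟩
    have := Nat.find_min' h hn
    omega
  · exact ⟨p, fun i => Or.inl rfl, fun n hn => (h ⟨_, hn⟩).elim⟩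

theorem copsWin_of_catchable {k : ℕ} (p : Fin k → V) (h : ∀ r, G.Catchable p r) :
    G.CopsWin k := by
  choose next hlegal hnext using exists_optimal_answer (G := G) (ι := Fin k)
  let pos : List V → Fin k → V := fun l => l.rec p fun r _ q => next q r
  refine ⟨⟨pos, fun h r i => hlegal (pos h) r i⟩, fun r hr => ?_⟩
  have key : ∀ n t, G.CatchableIn n (pos (robberHistory r t)) (r t) →
      ∃ (m : ℕ) (i : Fin k), pos (robberHistory r (m + 1)) i = r m := by
    intro n
    induction n with
    | zero => exact fun t ht => ht.elim
    | succ n ih =>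
      intro t ht
      rcases hnext _ _ n ht with ⟨i, hi⟩ | hc
      · exact ⟨t, i, hi⟩
      · exact ih (t + 1) (hc _ (hr t))
  obtain ⟨n, hn⟩ := h (r 0)
  exact key n 0 hn

end Game

/-! ### Guarding all cliques of a partition but one -/

section ColouredGame

variable {V κ : Type*} {G : SimpleGraph V} {f : V → κ}

/-- The classes of `f` are cliques. -/
def IsCliqueColouring (G : SimpleGraph V) (f : V → κ) : Prop :=
  ∀ u v, f u = f v → v = u ∨ G.Adj u v

/-- There is one cop for each index other than `e`, the cop with index `i` standing at `g i`. -/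
abbrev CatchableBut (G : SimpleGraph V) (e : κ) (g : κ → V) (r : V) : Prop :=
  G.Catchable (fun i : {i : κ // i ≠ e} => g i) r

theorem CatchableBut.of_guarded (hf : G.IsCliqueColouring f) {e i : κ} (hi : i ≠ e) {g : κ → V}
    {r : V} (h : f (g i) = f r) : G.CatchableBut e g r :=
  Catchable.of_step ⟨i, hi⟩ (hf _ _ h)

theorem CatchableBut.of_unguarded (hf : G.IsCliqueColouring f) {e c : κ} {g : κ → V} {r : V}
    (hg : ∀ d, d ≠ c → ∃ i, i ≠ e ∧ f (g i) = d)
    (h : f r = c → (∀ i, i ≠ e → ¬ G.Step (g i) r) → G.CatchableBut e g r) :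
    G.CatchableBut e g r := by
  by_cases hc : f r = c
  · by_cases hs : ∃ i, i ≠ e ∧ G.Step (g i) r
    · obtain ⟨i, hi, hs⟩ := hs
      exact Catchable.of_step ⟨i, hi⟩ hs
    · push Not at hs
      exact h hc hs
  · obtain ⟨i, hi, hfi⟩ := hg _ hc
    exact CatchableBut.of_guarded hf hi hfi

/-- After the move to `g'` only the class `c` may lack a guard and the robber is outside it, so he
must enter it or be caught. -/
theorem CatchableBut.of_force [Finite V] (hf : G.IsCliqueColouring f) {e c : κ} {g : κ → V}
    (g' : κ → V) {r : V} (hl : ∀ i, i ≠ e → G.Step (g i) (g' i))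
    (hg : ∀ d, d ≠ c → ∃ i, i ≠ e ∧ f (g' i) = d)
    (hr : f r ≠ c)
    (h : ∀ r', G.Adj r r' → f r' = c → (∀ i, i ≠ e → ¬ G.Step (g' i) r') →
      G.CatchableBut e g' r') : G.CatchableBut e g r := by
  refine Catchable.of_move (q := fun i : {i : κ // i ≠ e} => g' i) (fun i => hl i i.2)
    fun r' hr' => ?_
  refine CatchableBut.of_unguarded hf hg fun hc hs => h r' ?_ hc hs
  rcases hr' with rfl | hr'
  · exact (hr hc).elim
  · exact hr'

variable [Finite V] [DecidableEq κ]

/-- If two colours are not joined by an edge, then the cop guarding one of them is free to enter the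
other. -/
theorem catchableBut_of_not_joined (hf : G.IsCliqueColouring f) (hconn : G.Connected) {g : κ → V}
    (hg : ∀ i, f (g i) = i) {e j : κ} (hj : j ≠ e)
    (hej : ∀ u v, f u = e → f v = j → ¬ G.Adj u v) (r : V) : G.CatchableBut e g r := by
  have key : ∀ u v : V, G.Walk u v → f v = e → ∀ r, f r = e →
      G.CatchableBut e (Function.update g j u) r := by
    intro u v w hv
    induction w with
    | nil => exact fun r hr => .of_guarded hf hj (by simp [hv, hr])
    | @cons u u' v hu w ih =>
      intro r hr
      refine Catchable.of_move (q := fun i : {i : κ // i ≠ e} => Function.update g j u' i)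
        (fun i => ?_) fun r' hr' => ?_
      · by_cases hi : (i : κ) = j
        · simp [hi, Step, hu]
        · simp [hi, Step]
      · by_cases he : f r' = e
        · exact ih hv r' he
        · have hrj : f r' ≠ j := fun h => by
            rcases hr' with rfl | hr'
            · exact he hr
            · exact hej _ _ hr h hr'
          exact CatchableBut.of_guarded hf he (by simp [hrj, hg])
  refine .of_unguarded hf (c := e) (fun d hd => ⟨d, hd, hg d⟩) fun hr _ => ?_
  obtain ⟨w⟩ := hconn.preconnected (g j) (g e)
  simpa using key _ _ w (hg e) r hr

/-- An induced path on three vertices of different colours whose ends see a common fourth colour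
lets the cops chase the robber around an induced 5-cycle. -/
theorem catchableBut_of_path (hf : G.IsCliqueColouring f)
    (h5 : ∀ a x z c b, G.Adj a x → G.Adj x z → G.Adj z c → G.Adj c b → G.Adj b a →
      ¬ G.Adj a z → ¬ G.Adj x c → ¬ G.Adj z b → ¬ G.Adj c a → ¬ G.Adj b x → False)
    {g : κ → V} (hg : ∀ i, f (g i) = i) {a b c d d' : V} (hab : G.Adj a b) (hbc : G.Adj b c)
    (hac : ¬ G.Adj a c) (had : G.Adj a d) (hcd : G.Adj c d') (hdd : f d = f d')
    (fab : f a ≠ f b) (fac : f a ≠ f c) (fbc : f b ≠ f c) (fad : f a ≠ f d) (fbd : f b ≠ f d)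
    (fcd : f c ≠ f d) :
    ∃ g' : κ → V, ∀ r, G.CatchableBut (f a) g' r := by
  set g₁ : κ → V := fun i => if i = f b then b else if i = f c then c else if i = f d then d else g i
    with hg₁
  have hg₁f : ∀ i, f (g₁ i) = i := fun i => by
    simp only [hg₁]; split_ifs <;> simp_all
  -- Cop `f d` takes over the class of `a`, and cop `f c` that of `d`; only the class of `c` is left
  -- open.
  set g₂ : κ → V := fun i => if i = f d then a else if i = f c then d' else g₁ i with hg₂
  have h₁b : g₁ (f b) = b := by simp [hg₁]
  have h₁c : g₁ (f c) = c := by simp [hg₁, fbc.symm]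
  have h₁d : g₁ (f d) = d := by simp [hg₁, fbd.symm, fcd.symm]
  have h₂b : g₂ (f b) = b := by simp [hg₂, fbc, fbd, h₁b]
  have h₂c : g₂ (f c) = d' := by simp [hg₂, fcd]
  have h₂d : g₂ (f d) = a := by simp [hg₂]
  refine ⟨g₁, fun r => .of_unguarded hf (c := f a) (fun i hi => ⟨i, hi, hg₁f i⟩) fun hr hr' => ?_⟩
  have hrb := hr' _ fab.symm
  have hrc := hr' _ fac.symm
  rw [h₁b] at hrb
  rw [h₁c] at hrc
  refine .of_force hf (c := f c) g₂ (fun i _ => ?_) (fun i hi => ?_) (hr ▸ fac) ?_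
  · by_cases hid : i = f d
    · subst hid; rw [h₁d, h₂d]; exact Or.inr had.symm
    · by_cases hic : i = f c
      · subst hic; rw [h₁c, h₂c]; exact Or.inr hcd
      · left; simp [hg₂, hid, hic]
  · by_cases hia : i = f a
    · exact ⟨f d, fad.symm, by rw [h₂d, hia]⟩
    · by_cases hid : i = f d
      · exact ⟨f c, fac.symm, by rw [h₂c, hid, hdd]⟩
      · exact ⟨i, hia, by simp [hg₂, hid, hi, hg₁f]⟩
  · intro z hrz hz hz'
    exfalso
    have hzb := hz' _ fab.symm
    have hza := hz' _ fad.symm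
    rw [h₂b] at hzb
    rw [h₂d] at hza
    simp only [Step, not_or] at hrb hrc hzb hza
    have har : G.Adj a r := (hf a r hr.symm).resolve_left fun h => hrb.2 (h ▸ hab.symm)
    have hzc : G.Adj z c := (hf z c hz).resolve_left fun h => hrc.2 (h ▸ hrz.symm)
    -- The robber's move from `r` to `z` closes the induced 5-cycle `a r z c b`.
    exact h5 a r z c b har hrz hzc hbc.symm hab.symm hza.2 (fun h => hrc.2 h.symm)
      (fun h => hzb.2 h.symm) (fun h => hac h.symm) hrb.2

/-- If induced paths as in `catchableBut_of_path` do not exist and any two colours are joined by an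
edge, then the cops win. -/
theorem catchableBut_of_no_path (hf : G.IsCliqueColouring f)
    {g : κ → V} (hg : ∀ i, f (g i) = i)
    (hjoin : ∀ i j : κ, i ≠ j → ∃ u v, f u = i ∧ f v = j ∧ G.Adj u v)
    (hpath : ∀ a b c d d' : V, G.Adj a b → G.Adj b c → G.Adj a d → G.Adj c d' → f d = f d' →
      f a ≠ f b → f a ≠ f c → f b ≠ f c → f a ≠ f d → f b ≠ f d → f c ≠ f d → G.Adj a c)
    {A B C D : κ} (hAB : A ≠ B) (hAC : A ≠ C) (hBC : B ≠ C) (hAD : A ≠ D) (hBD : B ≠ D)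
    (hCD : C ≠ D) :
    ∃ g' : κ → V, ∀ r, G.CatchableBut D g' r := by
  obtain ⟨b, d₁, hb, hd₁, hbd⟩ := hjoin B D hBD
  obtain ⟨c, d₂, hc, hd₂, hcd⟩ := hjoin C D hCD
  set g₁ : κ → V := fun i => if i = B then b else if i = C then c else g i with hg₁
  have hg₁f : ∀ i, f (g₁ i) = i := fun i => by
    simp only [hg₁]; split_ifs <;> simp_all
  have h₁B : g₁ B = b := by simp [hg₁]
  have h₁C : g₁ C = c := by simp [hg₁, hBC.symm]
  refine ⟨g₁, fun d => .of_unguarded hf (c := D) (fun i hi => ⟨i, hi, hg₁f i⟩) fun hd _ => ?_⟩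
  by_cases hy : ∃ y a, G.Adj d y ∧ f y = B ∧ G.Adj y a ∧ f a = A
  · obtain ⟨y, a, hdy, hyB, hya, haA⟩ := hy
    -- While cop `C` enters `D` and forces the robber into `C`, cop `A` prepares at `a'` to enter
    -- `C` next.
    obtain ⟨a', c', ha', hc', hac'⟩ := hjoin A C hAC
    set g₂ : κ → V := fun i => if i = A then a' else if i = B then y else if i = C then d₂ else g₁ i
      with hg₂
    have h₂A : g₂ A = a' := by simp [hg₂]
    have h₂B : g₂ B = y := by simp [hg₂, hAB.symm]
    have h₂C : g₂ C = d₂ := by simp [hg₂, hAC.symm, hBC.symm]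
    have h₂ : ∀ i, i ≠ C → f (g₂ i) = i := fun i hi => by
      simp only [hg₂]; split_ifs <;> simp [*]
    refine .of_force hf (c := C) g₂ (fun i _ => ?_) (fun i hi => ?_) (hd ▸ hCD.symm) ?_
    · by_cases hi : i = C
      · subst hi; rw [h₁C, h₂C]; exact Or.inr hcd
      · exact hf _ _ (by rw [hg₁f, h₂ i hi])
    · by_cases hiD : i = D
      · exact ⟨C, hCD, by rw [h₂C, hiD, hd₂]⟩
      · exact ⟨i, hiD, h₂ i hi⟩
    · intro x hdx hx hx'
      have hxy := hx' B hBD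
      rw [h₂B] at hxy
      simp only [Step, not_or] at hxy
      have hxA : ∀ a'', G.Adj x a'' → f a'' ≠ A := fun a'' hxa ha'' => by
        -- The ends of the path `x d y` both see `A`, so `x` and `y` would be adjacent.
        refine hxy.2 (hpath x d y a'' a hdx.symm hdy hxa hya ?_ ?_ ?_ ?_ ?_ ?_ ?_).symm <;>
          simp only [hd, hx, hyB, haA, ha'', ne_eq]
        exacts [hCD, hBC.symm, hBD.symm, hAC.symm, hAD.symm, hAB.symm]
      refine .of_force hf (c := A) (Function.update g₂ A c') (fun i _ => ?_) (fun i hi => ?_)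
        (hx ▸ hAC.symm) fun r' hr' hA _ => (hxA r' hr' hA).elim
      · by_cases hi : i = A
        · subst hi; simp [h₂A, Step, hac']
        · simp [hi, Step]
      · by_cases hiC : i = C
        · exact ⟨A, hAD, by simp [hiC, hc']⟩
        · by_cases hiD : i = D
          · exact ⟨C, hCD, by simp [hAC.symm, hiD, h₂C, hd₂]⟩
          · exact ⟨i, hiD, by simp [hi, h₂ i hiC]⟩
  · push Not at hy
    -- Now the robber is forced into `B`, at a vertex that sees nothing in `A`; cop `A` then enters
    -- `B`.
    obtain ⟨a', b', ha', hb', hab'⟩ := hjoin A B hAB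
    set g₂ : κ → V := fun i => if i = A then a' else if i = B then d₁ else g₁ i with hg₂
    have h₂A : g₂ A = a' := by simp [hg₂]
    have h₂B : g₂ B = d₁ := by simp [hg₂, hAB.symm]
    have h₂ : ∀ i, i ≠ B → f (g₂ i) = i := fun i hi => by
      simp only [hg₂]; split_ifs <;> first | exact hg₁f i | simp [*]
    refine .of_force hf (c := B) g₂ (fun i _ => ?_) (fun i hi => ?_) (hd ▸ hBD.symm) ?_
    · by_cases hi : i = B
      · subst hi; rw [h₁B, h₂B]; exact Or.inr hbd
      · exact hf _ _ (by rw [hg₁f, h₂ i hi])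
    · by_cases hiD : i = D
      · exact ⟨B, hBD, by rw [h₂B, hiD, hd₁]⟩
      · exact ⟨i, hiD, h₂ i hi⟩
    · intro y hdy hyB _
      refine .of_force hf (c := A) (Function.update g₂ A b') (fun i _ => ?_) (fun i hi => ?_)
        (hyB ▸ hAB.symm) fun r' hr' hA _ => (hy y r' hdy hyB hr' hA).elim
      · by_cases hi : i = A
        · subst hi; simp [h₂A, Step, hab']
        · simp [hi, Step]
      · by_cases hiB : i = B
        · exact ⟨A, hAD, by simp [hiB, hb']⟩
        · by_cases hiD : i = D
          · exact ⟨B, hBD, by simp [hAB.symm, hiD, h₂B, hd₁]⟩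
          · exact ⟨i, hiD, by simp [hi, h₂ i hiB]⟩

/-- In a connected graph without induced 5-cycles whose vertices are partitioned into `k ≥ 4`
nonempty cliques, `k - 1` cops win. -/
theorem exists_catchableBut (hf : G.IsCliqueColouring f) (hconn : G.Connected)
    (h5 : ∀ a x z c b, G.Adj a x → G.Adj x z → G.Adj z c → G.Adj c b → G.Adj b a →
      ¬ G.Adj a z → ¬ G.Adj x c → ¬ G.Adj z b → ¬ G.Adj c a → ¬ G.Adj b x → False)
    (hsurj : Function.Surjective f)
    {A B C D : κ} (hAB : A ≠ B) (hAC : A ≠ C) (hBC : B ≠ C) (hAD : A ≠ D) (hBD : B ≠ D)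
    (hCD : C ≠ D) :
    ∃ (e : κ) (g : κ → V), ∀ r, G.CatchableBut e g r := by
  obtain ⟨g, hg⟩ := hsurj.hasRightInverse
  by_cases hjoin : ∀ i j : κ, i ≠ j → ∃ u v, f u = i ∧ f v = j ∧ G.Adj u v
  · by_cases hpath : ∀ a b c d d' : V, G.Adj a b → G.Adj b c → G.Adj a d → G.Adj c d' →
        f d = f d' → f a ≠ f b → f a ≠ f c → f b ≠ f c → f a ≠ f d → f b ≠ f d → f c ≠ f d →
        G.Adj a c
    · exact ⟨D, catchableBut_of_no_path hf hg hjoin hpath hAB hAC hBC hAD hBD hCD⟩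
    · push Not at hpath
      obtain ⟨a, b, c, d, d', hab, hbc, had, hcd, hdd, h1, h2, h3, h4, h5', h6, hac⟩ := hpath
      exact ⟨f a, catchableBut_of_path hf h5 hg hab hbc hac had hcd hdd h1 h2 h3 h4 h5' h6⟩
  · push Not at hjoin
    obtain ⟨i, j, hij, h⟩ := hjoin
    exact ⟨i, g, catchableBut_of_not_joined hf hconn hg hij.symm h⟩

end ColouredGame

/-! ### Clique covers of perfect graphs -/

section Perfect

variable {V : Type*} {G : SimpleGraph V}

theorem IsPerfect.colorable_induce [Finite V] (hG : G.IsPerfect) (s : Set V) :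
    (G.induce s).Colorable (G.induce s).cliqueNum := by
  rw [← chromaticNumber_le_iff_colorable, hG s]

theorem IsPerfect.exists_isClique [Finite V] (hG : G.IsPerfect) (s : Finset V) :
    ∃ t ⊆ s, G.IsClique (t : Set V) ∧
      ∃ c : V → ℕ, (∀ v ∈ s, c v < t.card) ∧ ∀ u ∈ s, ∀ v ∈ s, G.Adj u v → c u ≠ c v := by
  classical
  obtain ⟨t, ht⟩ := (G.induce (s : Set V)).exists_isNClique_cliqueNum
  obtain ⟨c⟩ := hG.colorable_induce (s : Set V)
  refine ⟨t.map (Function.Embedding.subtype _), ?_, ?_,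
    fun v => if h : v ∈ s then c ⟨v, h⟩ else 0, ?_, ?_⟩
  · intro v hv
    simp only [Finset.mem_map, Function.Embedding.subtype_apply, Subtype.exists] at hv
    obtain ⟨w, hw, -, rfl⟩ := hv
    exact hw
  · rintro u hu v hv huv
    simp only [Finset.coe_map, Function.Embedding.subtype_apply, Set.mem_image, Finset.mem_coe] at hu hv
    obtain ⟨u, hu, rfl⟩ := hu
    obtain ⟨v, hv, rfl⟩ := hv
    exact ht.isClique hu hv fun h => huv (congrArg _ h)
  · intro v hv
    simp only [hv, dif_pos, Finset.card_map, ht.card_eq]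
    exact Fin.is_lt _
  · intro u hu v hv huv
    simp only [hu, hv, dif_pos]
    intro h
    exact c.valid (v := ⟨u, hu⟩) (w := ⟨v, hv⟩) huv (Fin.ext h)

theorem IsPerfect.no_induced_five_cycle [Finite V] (hG : G.IsPerfect) (a x z c b : V)
    (hax : G.Adj a x) (hxz : G.Adj x z) (hzc : G.Adj z c) (hcb : G.Adj c b) (hba : G.Adj b a)
    (haz : ¬ G.Adj a z) (hxc : ¬ G.Adj x c) (hzb : ¬ G.Adj z b) (hca : ¬ G.Adj c a)
    (hbx : ¬ G.Adj b x) : False := by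
  classical
  obtain ⟨t, ht, hcl, col, hlt, hcol⟩ := hG.exists_isClique {a, x, z, c, b}
  have ht2 : t.card ≤ 2 := by
    by_contra! h
    obtain ⟨u, v, w, hu, hv, hw, huv, huw, hvw⟩ := Finset.two_lt_card_iff.1 h
    have h1 := hcl hu hv huv
    have h2 := hcl hu hw huw
    have h3 := hcl hv hw hvw
    have hu := ht hu
    have hv := ht hv
    have hw := ht hw
    simp only [Finset.mem_insert, Finset.mem_singleton] at hu hv hw
    rw [G.adj_comm] at haz hxc hzb hca hbx
    rcases hu with rfl | rfl | rfl | rfl | rfl <;> rcases hv with rfl | rfl | rfl | rfl | rfl <;>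
      first
      | exact huv rfl
      | exact absurd h1 ‹_›
      | exact absurd h1.symm ‹_›
      | (rcases hw with rfl | rfl | rfl | rfl | rfl <;>
          first
          | exact huw rfl
          | exact hvw rfl
          | exact absurd h2 ‹_›
          | exact absurd h2.symm ‹_›
          | exact absurd h3 ‹_›
          | exact absurd h3.symm ‹_›)
  have e1 := hcol a (by simp) x (by simp) hax
  have e2 := hcol x (by simp) z (by simp) hxz
  have e3 := hcol z (by simp) c (by simp) hzc
  have e4 := hcol c (by simp) b (by simp) hcb
  have e5 := hcol b (by simp) a (by simp) hba
  have l1 := hlt a (by simp)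
  have l2 := hlt x (by simp)
  have l3 := hlt z (by simp)
  have l4 := hlt c (by simp)
  have l5 := hlt b (by simp)
  omega

/-- Finite sets `S i`, and sets `K i` meeting every `S j` in exactly one point except for `S i`,
which `K i` avoids: there are at most as many indices as points. -/
theorem card_le_card_of_inter {ι : Type*} [Fintype ι] [DecidableEq V] (s : Finset V)
    (S K : ι → Finset V) (hS : ∀ i, S i ⊆ s) (hι : Fintype.card ι ≠ 1)
    (h0 : ∀ i, (K i ∩ S i).card = 0) (h1 : ∀ i j, j ≠ i → (K i ∩ S j).card = 1) :
    Fintype.card ι ≤ s.card := by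
  classical
  let v : ι → s → ℚ := fun i x => if (x : V) ∈ S i then 1 else 0
  -- The numbers `(K i ∩ S j).card` form the matrix `J - I`, nonsingular unless it has size 1.
  have hv : LinearIndependent ℚ v := by
    rw [Fintype.linearIndependent_iff]
    intro c hc
    have hsum : ∀ i, ∑ j, c j * ((K i ∩ S j).card : ℚ) = 0 := by
      intro i
      have hx : ∀ x : s, ∑ j, c j * (if (x : V) ∈ S j then 1 else 0) = 0 := fun x => by
        simpa [v] using congrFun hc x
      calc ∑ j, c j * ((K i ∩ S j).card : ℚ)
          = ∑ j, ∑ x : s, c j * (if (x : V) ∈ S j then 1 else 0) *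
              (if (x : V) ∈ K i then 1 else 0) := by
            refine Finset.sum_congr rfl fun j _ => ?_
            simp only [mul_assoc, ← Finset.mul_sum]
            congr 1
            rw [Finset.sum_coe_sort s fun x =>
              ((if x ∈ S j then 1 else 0) * (if x ∈ K i then 1 else 0) : ℚ)]
            have : K i ∩ S j = s.filter fun x => x ∈ S j ∧ x ∈ K i := by
              ext x
              simp only [Finset.mem_inter, Finset.mem_filter]
              exact ⟨fun h => ⟨hS j h.2, h.2, h.1⟩, fun h => ⟨h.2.2, h.2.1⟩⟩
            rw [this, Finset.card_filter]
            push_cast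
            refine Finset.sum_congr rfl fun x _ => ?_
            split_ifs <;> simp_all
        _ = ∑ x : s, (∑ j, c j * (if (x : V) ∈ S j then 1 else 0)) *
              (if (x : V) ∈ K i then 1 else 0) := by
            rw [Finset.sum_comm]
            simp only [Finset.sum_mul]
        _ = 0 := by simp only [hx, zero_mul, Finset.sum_const_zero]
    have hc' : ∀ i, c i = ∑ j, c j := by
      intro i
      have h := hsum i
      rw [← Finset.add_sum_erase _ _ (Finset.mem_univ i), h0 i] at h
      rw [← Finset.add_sum_erase _ _ (Finset.mem_univ i)]
      have : ∑ j ∈ Finset.univ.erase i, c j * ((K i ∩ S j).card : ℚ) =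
          ∑ j ∈ Finset.univ.erase i, c j :=
        Finset.sum_congr rfl fun j hj => by rw [h1 i j (Finset.ne_of_mem_erase hj)]; simp
      rw [this] at h
      simp only [Nat.cast_zero, mul_zero, zero_add] at h
      rw [h, add_zero]
    have ht : ∑ j, c j = (Fintype.card ι : ℚ) * ∑ j, c j := by
      conv_lhs => rw [Finset.sum_congr rfl fun i _ => hc' i]
      simp
    have hcard : (Fintype.card ι : ℚ) - 1 ≠ 0 := by
      rw [sub_ne_zero]; exact_mod_cast hι
    have ht0 : ∑ j, c j = 0 := by
      have : ((Fintype.card ι : ℚ) - 1) * ∑ j, c j = 0 := by linarith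
      exact (mul_eq_zero.1 this).resolve_left hcard
    exact fun i => (hc' i).trans ht0
  simpa using hv.fintype_card_le_finrank

/-- In a perfect graph, a set of vertices without independent subsets of more than `k` vertices is
covered by `k` cliques. -/
theorem IsPerfect.exists_clique_cover [Finite V] (hG : G.IsPerfect) (s : Finset V) (k : ℕ)
    (hk : ∀ t ⊆ s, G.IsIndepSet (t : Set V) → t.card ≤ k) :
    ∃ f : V → ℕ, (∀ v ∈ s, f v < k) ∧ ∀ u ∈ s, ∀ v ∈ s, u ≠ v → f u = f v → G.Adj u v := by
  classical
  induction s using Finset.strongInduction generalizing k with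
  | H s ih =>
  by_contra hcon
  rcases Nat.eq_zero_or_pos k with rfl | hkpos
  · refine hcon ⟨fun _ => 0, fun v hv => ?_, fun u hu => ?_⟩
    · have := hk {v} (by simpa using hv) (by simp [IsIndepSet])
      simp at this
    · have := hk {u} (by simpa using hu) (by simp [IsIndepSet])
      simp at this
  obtain ⟨Q, hQs, hQ, col, hcol, hcol'⟩ := hG.exists_isClique s
  have hle : s.card ≤ Q.card * k := by
    have := Finset.card_le_mul_card_image_of_maps_to (f := col) (s := s) (t := Finset.range Q.card)
      (fun v hv => Finset.mem_range.2 (hcol v hv)) k fun i _ => hk _ (Finset.filter_subset _ _) ?_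
    · rwa [Finset.card_range, mul_comm] at this
    · intro u hu v hv _ huv
      simp only [Finset.coe_filter, Set.mem_ofPred_eq] at hu hv
      exact hcol' u hu.1 v hv.1 huv (hu.2.trans hv.2.symm)
  have hcov : ∀ q : Q, ∃ f : V → ℕ, (∀ v ∈ s.erase q, f v < k) ∧
      ∀ u ∈ s.erase q, ∀ v ∈ s.erase q, u ≠ v → f u = f v → G.Adj u v := fun q =>
    ih _ (Finset.erase_ssubset (hQs q.2)) k fun t ht => hk t (ht.trans (Finset.erase_subset _ _))
  choose F hF hF' using hcov
  -- In a minimal counterexample, `Q` and the covers of all `s.erase q` give `Q.card * k + 1`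
  -- cliques, more than `s` has points.
  let S : Option (Q × Fin k) → Finset V := fun o =>
    o.elim Q fun x => (s.erase x.1).filter fun v => F x.1 v = x.2
  have hSs : ∀ o, S o ⊆ s := by
    rintro (_ | x)
    · exact hQs
    · exact (Finset.filter_subset _ _).trans (Finset.erase_subset _ _)
  have hSc : ∀ o, G.IsClique (S o : Set V) := by
    rintro (_ | x)
    · exact hQ
    · intro u hu v hv huv
      simp only [S, Option.elim, Finset.coe_filter, Set.mem_ofPred_eq] at hu hv
      exact hF' x.1 u hu.1 v hv.1 huv (hu.2.trans hv.2.symm)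
  -- Otherwise `k - 1` cliques cover `s \ S o`, and `S o` completes a cover of `s`.
  have hK : ∀ o, ∃ K : Finset V, K ⊆ s \ S o ∧ G.IsIndepSet (K : Set V) ∧ K.card = k := by
    intro o
    by_contra! hno
    have hsmall : ∀ t ⊆ s \ S o, G.IsIndepSet (t : Set V) → t.card ≤ k - 1 := fun t ht hi => by
      have h1 := hk t (ht.trans Finset.sdiff_subset) hi
      have h2 := hno t ht hi
      omega
    apply hcon
    obtain ⟨f, hf, hf'⟩ : ∃ f : V → ℕ, (∀ v ∈ s \ S o, f v < k - 1) ∧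
        ∀ u ∈ s \ S o, ∀ v ∈ s \ S o, u ≠ v → f u = f v → G.Adj u v := by
      rcases Finset.eq_empty_or_nonempty (S o) with h | h
      -- An empty `S o` leaves `s` no smaller, so a point of `Q` is removed instead and serves as
      -- the last clique.
      · exfalso
        rw [h, Finset.sdiff_empty] at hsmall hno
        apply hcon
        rcases Finset.eq_empty_or_nonempty Q with hQe | ⟨q, hq⟩
        · rw [hQe] at hle
          simp only [Finset.card_empty, zero_mul, nonpos_iff_eq_zero, Finset.card_eq_zero] at hle
          exact ⟨fun _ => 0, by simp [hle], by simp [hle]⟩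
        · obtain ⟨f, hf, hf'⟩ := ih _ (Finset.erase_ssubset (hQs hq)) (k - 1)
            fun t ht => hsmall t (ht.trans (Finset.erase_subset _ _))
          refine ⟨fun v => if v = q then k - 1 else f v, fun v hv => ?_, fun u hu v hv huv => ?_⟩
          · by_cases hvq : v = q
            · simp [hvq]; omega
            · have := hf v (Finset.mem_erase.2 ⟨hvq, hv⟩)
              simp [hvq]; omega
          · by_cases huq : u = q <;> by_cases hvq : v = q
            · exact (huv (huq.trans hvq.symm)).elim
            · have := hf v (Finset.mem_erase.2 ⟨hvq, hv⟩)
              simp [huq, hvq]; omega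
            · have := hf u (Finset.mem_erase.2 ⟨huq, hu⟩)
              simp [huq, hvq]; omega
            · simpa [huq, hvq] using hf' u (Finset.mem_erase.2 ⟨huq, hu⟩) v
                (Finset.mem_erase.2 ⟨hvq, hv⟩) huv
      · exact ih _ (Finset.sdiff_ssubset (hSs o) h) (k - 1) hsmall
    refine ⟨fun v => if v ∈ S o then k - 1 else f v, fun v hv => ?_, fun u hu v hv huv => ?_⟩
    · by_cases hvS : v ∈ S o
      · simp [hvS]; omega
      · have := hf v (Finset.mem_sdiff.2 ⟨hv, hvS⟩)
        simp [hvS]; omega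
    · by_cases huS : u ∈ S o <;> by_cases hvS : v ∈ S o
      · exact fun _ => hSc o huS hvS huv
      · have := hf v (Finset.mem_sdiff.2 ⟨hv, hvS⟩)
        simp [huS, hvS]; omega
      · have := hf u (Finset.mem_sdiff.2 ⟨hu, huS⟩)
        simp [huS, hvS]; omega
      · simpa [huS, hvS] using hf' u (Finset.mem_sdiff.2 ⟨hu, huS⟩) v
          (Finset.mem_sdiff.2 ⟨hv, hvS⟩) huv
  choose K hKs hKi hKc using hK
  have hinter : ∀ i j, (K i ∩ S j).card ≤ 1 := fun i j => by
    rw [Finset.card_le_one]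
    intro u hu v hv
    by_contra huv
    rw [Finset.mem_inter] at hu hv
    exact hKi i hu.1 hv.1 huv (hSc j hu.2 hv.2 huv)
  have hself : ∀ i, (K i ∩ S i).card = 0 := fun i => by
    rw [Finset.card_eq_zero, ← Finset.disjoint_iff_inter_eq_empty]
    exact Finset.disjoint_of_subset_left (hKs i) Finset.sdiff_disjoint
  -- The cover of `s.erase q` misses one point of `K i` exactly when `q ∈ K i`; the term for `Q`
  -- makes up for this.
  have htotal : ∀ i, ∑ j, (K i ∩ S j).card = Q.card * k := fun i => by
    have hKs' : K i ⊆ s := (hKs i).trans Finset.sdiff_subset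
    have hq : ∀ q : Q, ∑ c : Fin k, (K i ∩ S (some (q, c))).card = ((K i).erase q).card := by
      intro q
      rw [Finset.card_eq_sum_card_fiberwise (f := F q) (t := Finset.range k)
        (s := (K i).erase q), Finset.sum_range]
      · refine Finset.sum_congr rfl fun c _ => congrArg _ ?_
        ext v
        simp only [S, Option.elim, Finset.mem_inter, Finset.mem_filter, Finset.mem_erase]
        exact ⟨fun h => ⟨⟨h.2.1.1, h.1⟩, h.2.2⟩, fun h => ⟨h.1.2, ⟨h.1.1, hKs' h.1.2⟩, h.2⟩⟩
      · intro v hv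
        have hv := Finset.mem_erase.1 hv
        exact Finset.mem_coe.2 (Finset.mem_range.2 (hF q v (Finset.mem_erase.2 ⟨hv.1, hKs' hv.2⟩)))
    have hQK : (K i ∩ Q).card = ∑ q : Q, if (q : V) ∈ K i then 1 else 0 := by
      rw [Finset.sum_coe_sort Q fun q => if q ∈ K i then 1 else 0, ← Finset.card_filter,
        Finset.filter_mem_eq_inter, Finset.inter_comm]
    rw [Fintype.sum_option, Fintype.sum_prod_type]
    simp only [hq]
    change (K i ∩ Q).card + _ = _
    rw [hQK, ← Finset.sum_add_distrib]
    have : ∀ q : Q, ((if (q : V) ∈ K i then 1 else 0) + ((K i).erase q).card) = k := fun q => by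
      by_cases h : (q : V) ∈ K i
      · rw [if_pos h, Finset.card_erase_of_mem h, hKc]; omega
      · rw [if_neg h, Finset.erase_eq_of_notMem h, hKc, zero_add]
    simp [this]
  have hone : ∀ i j, j ≠ i → (K i ∩ S j).card = 1 := fun i j hj => by
    by_contra hne
    have hlt : ∑ l, (K i ∩ S l).card < ∑ l, if l = i then 0 else 1 := by
      refine Finset.sum_lt_sum (fun l _ => ?_) ⟨j, Finset.mem_univ _, ?_⟩
      · split_ifs with h
        · rw [h, hself]
        · exact hinter i l
      · rw [if_neg hj]
        have := hinter i j
        omega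
    rw [htotal] at hlt
    have : (∑ l, if l = i then 0 else 1) + 1 = Fintype.card (Option (Q × Fin k)) := by
      rw [← Finset.card_univ, Finset.card_eq_sum_ones,
        ← Finset.add_sum_erase _ _ (Finset.mem_univ i),
        ← Finset.add_sum_erase (Finset.univ) (fun _ => 1) (Finset.mem_univ i), if_pos rfl,
        Finset.sum_congr rfl fun l hl => if_neg (Finset.ne_of_mem_erase hl)]
      omega
    rw [Fintype.card_option, Fintype.card_prod, Fintype.card_coe, Fintype.card_fin] at this
    omega
  have hcard : Fintype.card (Option (Q × Fin k)) = Q.card * k + 1 := by simp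
  have := card_le_card_of_inter s S K hSs ?_ hself hone
  · omega
  · rw [hcard]
    intro h
    have hs0 : s = ∅ := by
      rw [← Finset.card_eq_zero]; omega
    exact hcon ⟨fun _ => 0, by simp [hs0], by simp [hs0]⟩

theorem IsPerfect.exists_isCliqueColouring [Finite V] (hG : G.IsPerfect) :
    ∃ f : V → Fin G.indepNum, G.IsCliqueColouring f ∧ Function.Surjective f := by
  classical
  have := Fintype.ofFinite V
  obtain ⟨f, hf, hf'⟩ := hG.exists_clique_cover Finset.univ G.indepNum
    fun t _ ht => ht.card_le_indepNum
  refine ⟨fun v => ⟨f v, hf v (Finset.mem_univ v)⟩, fun u v h => ?_, ?_⟩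
  · by_cases huv : v = u
    · exact Or.inl huv
    · exact Or.inr (hf' u (Finset.mem_univ u) v (Finset.mem_univ v) (Ne.symm huv)
        (congrArg Fin.val h))
  -- A maximum independent set meets each clique at most once, hence every clique.
  · obtain ⟨t, ht⟩ := G.exists_isNIndepSet_indepNum
    have hinj : Function.Injective fun v : t =>
        (⟨f v, hf v (Finset.mem_univ _)⟩ : Fin G.indepNum) := fun u v h => by
      by_contra huv
      have huv' : (u : V) ≠ v := fun h => huv (Subtype.ext h)
      exact ht.isIndepSet u.2 v.2 huv'
        (hf' u (Finset.mem_univ _) v (Finset.mem_univ _) huv' (congrArg Fin.val h))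
    have hsurj := ((Fintype.bijective_iff_injective_and_card _).2
      ⟨hinj, by simp [ht.card_eq]⟩).2
    intro i
    obtain ⟨v, hv⟩ := hsurj i
    exact ⟨v, hv⟩

end Perfect

end SimpleGraph

theorem theorem3 {V : Type*} [Finite V] (G : SimpleGraph V) (hconn : G.Connected)
    (hperf : G.IsPerfect) (hα : 4 ≤ G.indepNum) : G.copNumber < G.indepNum := by
  obtain ⟨f, hf, hsurj⟩ := hperf.exists_isCliqueColouring
  obtain ⟨e, g, h⟩ := SimpleGraph.exists_catchableBut hf hconn hperf.no_induced_five_cycle hsurj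
    (A := ⟨0, by omega⟩) (B := ⟨1, by omega⟩) (C := ⟨2, by omega⟩) (D := ⟨3, by omega⟩)
    (by simp) (by simp) (by simp) (by simp) (by simp) (by simp)
  have hcard : Fintype.card {i : Fin G.indepNum // i ≠ e} = G.indepNum - 1 := by
    simp
  have hwin : G.CopsWin (G.indepNum - 1) :=
    SimpleGraph.copsWin_of_catchable _ fun r =>
      (h r).imp fun _ hn => hn.comp_equiv (Fintype.equivFinOfCardEq hcard).symm
  have hle : G.copNumber ≤ G.indepNum - 1 := Nat.sInf_le hwin
  omega
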